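/- **Setting.** Let $l>-\frac12$, $L_0\ge 0$, $E_0\in\,]0,1[$, and let $\Phi\colon\mathbb R\to[0,\infty[$ be a function in $L^\infty_{\mathrm{loc}}(\mathbb R)$ with $\Phi(\alpha)=0$ for $\alpha\le 0$ for which there are constants $c_1,c_2,\alpha_0>0$ and $0\le k<l+\frac32$ such that $c_1\alpha^k\le\Phi(\alpha)\le c_2\alpha^k$ for $0<\alpha\le\alpha_0$. Put $$\varphi(E,L)=\Phi\left(1-\frac{E}{E_0}\right)(L-L_0)_+^l,$$ where $(L-L_0)_+^l$ is $0$ for $L<L_0$ (and, for $l=0$, is $1$ for $L\ge L_0$). A *singularity-free steady state* of the spherically symmetric, asymptotically flat Einstein-Vlasov system with this ansatz is given by metric coefficients $\mu,\lambda\colon[0,\infty[\to\mathbb R$, continuous on $[0,\infty[$ and differentiable on $]0,\infty[$, and the phase space density $$f(x,v)=\varphi(E(x,v),L(x,v)),\qquad E(x,v)=e^{\mu(|x|)}\sqrt{1+|v|^2},\qquad L(x,v)=|x\times v|^2,\qquad x,v\in\mathbb R^3,$$ such that for all $r>0$ $$e^{-2\lambda}(2r\lambda'-1)+1=8\pi r^2\rho,\qquad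 e^{-2\lambda}(2r\mu'+1)-1=8\pi r^2p,$$ where, for $r=|x|>0$, $$\rho(r)=\int_{\mathbb R^3}\sqrt{1+|v|^2}\,f(x,v)\,dv,\qquad p(r)=\int_{\mathbb R^3}\left(\frac{x\cdot v}{r}\right)^2 f(x,v)\,\frac{dv}{\sqrt{1+|v|^2}},$$ and such that $\lambda(0)=0$, $\lim_{r\to\infty}\mu(r)=\lim_{r\to\infty}\lambda(r)=0$, and $\ln(E_0)-\mu(0)>0$. Let $$m(r)=4\pi\int_0^r\rho(s)s^2\,ds,\qquad \Psi_L(r)=e^{\mu(r)}\sqrt{1+\frac{L}{r^2}},\qquad I_L=\{r>0: \Psi_L(r)<E_0,\ \rho(r)>0\}.$$ The steady state is *isotropic* if $\varphi(E,L)$ does not depend on $L$ (for $E>0$, $L\ge0$). It has *single-well structure* if for every $L>0$ with $L\ge L_0$ and $I_L\ne\emptyset$ there is exactly one radius $r_L\in I_L$ with $\Psi_L'(r_L)=0$. **Lemma.** Every isotropic singularity-free steady state with $$\frac{2m(r)}{r}\le\frac13\qquad\text{for all } r>0$$ has single-well structure. -/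

import Mathlib

open Set Filter Topology MeasureTheory

noncomputable section

namespace EinsteinVlasov

/-- Euclidean three-space, carrying the positions `x` as well as the velocities `v`. -/
abbrev Space : Type := EuclideanSpace ℝ (Fin 3)

/-- The particle energy `E(x,v) = e^{μ(|x|)} √(1+|v|²)` induced by the metric coefficient `μ`. -/
def particleEnergy (μ : ℝ → ℝ) (x v : Space) : ℝ :=
  Real.exp (μ ‖x‖) * Real.sqrt (1 + ‖v‖ ^ 2)

/-- The (squared) angular momentum `L(x,v) = |x × v|²`. -/
def angularMomentum (x v : Space) : ℝ :=
  ‖(WithLp.toLp 2 (crossProduct x.ofLp v.ofLp) : Space)‖ ^ 2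

/-- The microscopic equation of state `φ(E,L) = Φ(1 - E/E₀) (L - L₀)₊^l`. The positive part power
vanishes for `L < L₀`; in particular it is the indicator function of `[L₀,∞[` for `l = 0`. -/
def eqOfState (Φ : ℝ → ℝ) (l L₀ E₀ : ℝ) (E L : ℝ) : ℝ :=
  Φ (1 - E / E₀) * (if L₀ ≤ L then (L - L₀) ^ l else 0)

/-- The point `(r,0,0)`, used to evaluate spherically symmetric functions at the radius `r`. -/
def radialPoint (r : ℝ) : Space := EuclideanSpace.single 0 r

/-- The mass density `ρ_f` at the radius `r` induced by a spherically symmetric `f`. -/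
def massDensity (f : Space → Space → ℝ) (r : ℝ) : ℝ :=
  ∫ v : Space, Real.sqrt (1 + ‖v‖ ^ 2) * f (radialPoint r) v

/-- The radial pressure `p_f` at the radius `r` induced by a spherically symmetric `f`. -/
def radialPressure (f : Space → Space → ℝ) (r : ℝ) : ℝ :=
  ∫ v : Space, (inner ℝ (radialPoint r) v / r) ^ 2 * f (radialPoint r) v
    / Real.sqrt (1 + ‖v‖ ^ 2)

/-- The admissible functions `Φ`: non-negative, in `L^∞_loc(ℝ)`, vanishing on `]-∞,0]`, and
comparable near `0+` to a power `α^k` with `0 ≤ k < l + 3/2`. -/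
structure Admissible (Φ : ℝ → ℝ) (l : ℝ) : Prop where
  nonneg : ∀ α, 0 ≤ Φ α
  locBounded : ∀ K : Set ℝ, IsCompact K → MemLp Φ ⊤ (volume.restrict K)
  eq_zero : ∀ α, α ≤ 0 → Φ α = 0
  power_bounds : ∃ c₁ c₂ α₀ k : ℝ, 0 < c₁ ∧ 0 < c₂ ∧ 0 < α₀ ∧ 0 ≤ k ∧ k < l + 3 / 2 ∧
    ∀ α, 0 < α → α ≤ α₀ → c₁ * α ^ k ≤ Φ α ∧ Φ α ≤ c₂ * α ^ k

/-- A static solution of the singularity-free, spherically symmetric, asymptotically flat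
Einstein-Vlasov system generated by the ansatz `f = φ(E,L)`.

The unknowns are the metric coefficients `μ`, `lam` on `[0,∞[`, where the metric reads
`-e^{2μ} dt² + e^{2 lam} dr² + r² (dϑ² + sin²ϑ dφ²)`, and the cut-off energy `E₀`. Since `E` and `L`
are conserved along characteristics, the ansatz takes care of the Vlasov equation, and the system
reduces to the two field equations below together with the boundary conditions. (The remaining
field equations and the compactness of the support of `f` are consequences; nothing of this kind
is assumed.) -/
structure SteadyState where
  Φ : ℝ → ℝ
  l : ℝ
  L₀ : ℝ
  E₀ : ℝ
  μ : ℝ → ℝ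
  lam : ℝ → ℝ
  l_gt : -(1 / 2) < l
  L₀_nonneg : 0 ≤ L₀
  admissible : Admissible Φ l
  E₀_pos : 0 < E₀
  E₀_lt_one : E₀ < 1
  μ_continuousOn : ContinuousOn μ (Ici 0)
  lam_continuousOn : ContinuousOn lam (Ici 0)
  μ_differentiableAt : ∀ r, 0 < r → DifferentiableAt ℝ μ r
  lam_differentiableAt : ∀ r, 0 < r → DifferentiableAt ℝ lam r
  /-- The initial value `y(0)` of `y = ln E₀ - μ` is positive. -/
  central_value : 0 < Real.log E₀ - μ 0
  /-- The centre is regular. -/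
  lam_zero : lam 0 = 0
  /-- Asymptotic flatness. -/
  μ_tendsto : Tendsto μ atTop (𝓝 0)
  lam_tendsto : Tendsto lam atTop (𝓝 0)
  fieldEq_density : ∀ r, 0 < r →
    Real.exp (-2 * lam r) * (2 * r * deriv lam r - 1) + 1 =
      8 * Real.pi * r ^ 2 *
        massDensity (fun x v => eqOfState Φ l L₀ E₀ (particleEnergy μ x v) (angularMomentum x v)) r
  fieldEq_pressure : ∀ r, 0 < r →
    Real.exp (-2 * lam r) * (2 * r * deriv μ r + 1) - 1 =
      8 * Real.pi * r ^ 2 *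
        radialPressure
          (fun x v => eqOfState Φ l L₀ E₀ (particleEnergy μ x v) (angularMomentum x v)) r

namespace SteadyState

variable (S : SteadyState)

/-- The microscopic equation of state of the steady state. -/
def φ (E L : ℝ) : ℝ := eqOfState S.Φ S.l S.L₀ S.E₀ E L

/-- The phase space density of the steady state. -/
def f (x v : Space) : ℝ := S.φ (particleEnergy S.μ x v) (angularMomentum x v)

/-- The mass density of the steady state. -/
def ρ (r : ℝ) : ℝ := massDensity S.f r

/-- The quasi-local mass `m(r) = 4π ∫₀^r ρ(s) s² ds`. -/
def m (r : ℝ) : ℝ := 4 * Real.pi * ∫ s in (0 : ℝ)..r, S.ρ s * s ^ 2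

/-- The steady state is isotropic: the microscopic equation of state depends only on the energy. -/
def IsIsotropic : Prop := ∃ ψ : ℝ → ℝ, ∀ E L : ℝ, 0 < E → 0 ≤ L → S.φ E L = ψ E

/-- The effective potential `Ψ_L(r) = e^{μ(r)} √(1 + L/r²)`. -/
def effPotential (L r : ℝ) : ℝ := Real.exp (S.μ r) * Real.sqrt (1 + L / r ^ 2)

/-- The set `I_L = {Ψ_L < E₀} ∩ {ρ > 0}` of radii. -/
def wellRegion (L : ℝ) : Set ℝ := {r | 0 < r ∧ S.effPotential L r < S.E₀ ∧ 0 < S.ρ r}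

/-- Single-well structure: for every `L > 0` with `L ≥ L₀` and `I_L ≠ ∅`, the effective potential
`Ψ_L` has exactly one critical point in `I_L`. -/
def HasSingleWellStructure : Prop :=
  ∀ L : ℝ, 0 < L → S.L₀ ≤ L → (S.wellRegion L).Nonempty →
    ∃! r, r ∈ S.wellRegion L ∧ deriv (S.effPotential L) r = 0

end SteadyState

end EinsteinVlasov

end

/-! Write q = rμ' (`logSlope`), M = m/r, P = 4πr²p, R = 4πr²ρ. The critical points of Ψ_L are the
zeros of h = q(r² + L) - L. Uniqueness rests on h' > 0 at every zero of h where ρ > 0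
(`deriv_pos_at_critical`), since a function with this property on an interval cannot vanish twice
there (`not_two_zeros_of_deriv_pos`). At a zero, q = L/(r² + L) < 1, and the field equations with
the Tolman-Oppenheimer-Volkoff equation turn h' into a positive multiple of R(1 + q) + M(1 - 4q) +
P(4 - 3q), which is positive because M ≤ 1/6 (`well_polynomial_pos`). The whole interval between two
critical points in I_L carries matter: μ is increasing, e^μ ≤ Ψ_L, and in the isotropic case ρ > 0
wherever e^μ < E₀.

Existence: Ψ_L ≥ E₀ at some radius near the centre and at some large radius, so a minimum over the
compact interval between them is interior once Ψ_L < E₀ somewhere inside.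

Isotropy makes ρ and p functions of μ alone, given by one-dimensional energy moments. These are
regular enough to differentiate p although Φ is only locally bounded (`IsIsotropic.hasDerivAt_p`).
-/

noncomputable section
namespace EinsteinVlasov

/-! ### Energy moments and their dependence on the lower cut-off -/

section EnergyIntegrals

/-- `∫₀^∞ √(E² - t) g(E) dE`, the integrand being cut off where `E² < t`. -/
def sqrtMoment (g : ℝ → ℝ) (t : ℝ) : ℝ := ∫ E in Ioi (0 : ℝ), √(E ^ 2 - t) * g E

/-- `∫₀^∞ (E² - t)^{3/2} g(E) dE`, the integrand being cut off where `E² < t`. -/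
def threeHalvesMoment (g : ℝ → ℝ) (t : ℝ) : ℝ :=
  ∫ E in Ioi (0 : ℝ), ((E ^ 2 - t) * √(E ^ 2 - t)) * g E

/-- As `√` vanishes on negative numbers, `x * √x` is the 3/2 power of the positive part, hence C¹
across 0. The cut-off in the moments therefore needs no boundary term. -/
lemma hasDerivAt_mul_sqrt (x : ℝ) : HasDerivAt (fun x : ℝ => x * √x) (3 / 2 * √x) x := by
  rcases lt_trichotomy x 0 with hx | rfl | hx
  · have h : (fun x : ℝ => x * √x) =ᶠ[𝓝 x] fun _ => (0 : ℝ) := by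
      filter_upwards [gt_mem_nhds hx] with y hy
      simp [Real.sqrt_eq_zero_of_nonpos hy.le]
    rw [Real.sqrt_eq_zero_of_nonpos hx.le, mul_zero]
    exact (hasDerivAt_const x (0 : ℝ)).congr_of_eventuallyEq h
  · rw [hasDerivAt_iff_tendsto_slope]
    have h : Tendsto (fun x : ℝ => √x) (𝓝[≠] 0) (𝓝 (3 / 2 * √0)) := by
      simpa using (Real.continuous_sqrt.tendsto 0).mono_left nhdsWithin_le_nhds
    refine h.congr' ?_
    filter_upwards [self_mem_nhdsWithin] with y hy
    have hy' : y ≠ 0 := hy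
    simp [slope_def_field, hy']
  · have h := (hasDerivAt_id x).mul (Real.hasDerivAt_sqrt hx.ne')
    refine h.congr_deriv ?_
    have := Real.sq_sqrt hx.le
    have h0 := (Real.sqrt_pos.2 hx).ne'
    simp only [id]
    field_simp
    linarith

variable {g : ℝ → ℝ} {b : ℝ}

lemma integrableOn_continuous_mul (hg : IntegrableOn g (Ioi 0)) (hb : ∀ E, b ≤ E → g E = 0)
    {k : ℝ → ℝ} (hk : Continuous k) : IntegrableOn (fun E => k E * g E) (Ioi 0) := by
  have h1 : IntegrableOn (fun E => k E * g E) (Icc 0 b) :=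
    (((integrableOn_Ici_iff_integrableOn_Ioi (by simp)).2 hg).mono_set Icc_subset_Ici_self).continuousOn_mul
      hk.continuousOn isCompact_Icc
  refine (h1.of_forall_sdiff_eq_zero (t := Ici 0) measurableSet_Ici ?_).mono_set Ioi_subset_Ici_self
  rintro E ⟨hE, hE'⟩
  rw [hb E (le_of_lt ?_), mul_zero]
  by_contra! h
  exact hE' ⟨hE, h⟩

lemma hasDerivAt_threeHalvesMoment (hg : IntegrableOn g (Ioi 0)) (hb : ∀ E, b ≤ E → g E = 0)
    (t : ℝ) : HasDerivAt (threeHalvesMoment g) (-(3 / 2) * sqrtMoment g t) t := by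
  have key := hasDerivAt_integral_of_dominated_loc_of_deriv_le
    (μ := volume.restrict (Ioi (0 : ℝ))) (x₀ := t) (s := Ioi (t - 1))
    (F := fun x E => ((E ^ 2 - x) * √(E ^ 2 - x)) * g E)
    (F' := fun x E => -(3 / 2) * √(E ^ 2 - x) * g E)
    -- The kernel decreases in the cut-off, so its value at `t - 1` dominates for all `x > t - 1`.
    (bound := fun E => ‖3 / 2 * √(E ^ 2 - (t - 1)) * g E‖)
    (Ioi_mem_nhds (by linarith))
    (Eventually.of_forall fun x =>
      (integrableOn_continuous_mul hg hb (by fun_prop)).aestronglyMeasurable)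
    (integrableOn_continuous_mul hg hb (by fun_prop))
    (integrableOn_continuous_mul hg hb (by fun_prop)).aestronglyMeasurable
    (Eventually.of_forall fun E x hx => ?_)
    (integrableOn_continuous_mul hg hb (by fun_prop)).norm
    (Eventually.of_forall fun E x _ => ?_)
  · have h := key.2
    rw [show (fun E => -(3 / 2) * √(E ^ 2 - t) * g E) =
      fun E => -(3 / 2) * (√(E ^ 2 - t) * g E) from funext fun E => mul_assoc _ _ _,
      integral_const_mul] at h
    exact h
  · simp only [norm_mul, norm_neg]
    have : ‖√(E ^ 2 - x)‖ ≤ ‖√(E ^ 2 - (t - 1))‖ := by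
      rw [Real.norm_of_nonneg (Real.sqrt_nonneg _), Real.norm_of_nonneg (Real.sqrt_nonneg _)]
      exact Real.sqrt_le_sqrt (by linarith [mem_Ioi.1 hx])
    gcongr
  · have h := ((hasDerivAt_mul_sqrt (E ^ 2 - x)).comp x
      ((hasDerivAt_id x).const_sub (E ^ 2))).mul_const (g E)
    exact h.congr_deriv (by ring)

lemma integral_Ioi_sq_mul_sqrt (hg : IntegrableOn g (Ioi 0)) (hb : ∀ E, b ≤ E → g E = 0) (t : ℝ) :
    ∫ E in Ioi (0 : ℝ), E ^ 2 * √(E ^ 2 - t) * g E =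
      threeHalvesMoment g t + t * sqrtMoment g t := by
  rw [threeHalvesMoment, sqrtMoment, ← integral_const_mul, ← integral_add]
  · congr 1 with E
    ring
  · exact integrableOn_continuous_mul hg hb (by fun_prop)
  · exact (integrableOn_continuous_mul hg hb (by fun_prop)).const_mul t

lemma threeHalvesMoment_nonneg (hg0 : ∀ E, 0 ≤ g E) (t : ℝ) : 0 ≤ threeHalvesMoment g t := by
  refine integral_nonneg fun E => mul_nonneg ?_ (hg0 E)
  rcases le_total 0 (E ^ 2 - t) with h | h
  · positivity
  · simp [Real.sqrt_eq_zero_of_nonpos h]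

lemma sqrtMoment_pos (hg : IntegrableOn g (Ioi 0)) (hb : ∀ E, b ≤ E → g E = 0)
    (hg0 : ∀ E, 0 ≤ g E) {a c : ℝ} (ha : 0 < a) (hab : a < b) (hcb : c < b)
    (hpos : ∀ E, c < E → E < b → 0 < g E) : 0 < sqrtMoment g (a ^ 2) := by
  rw [sqrtMoment, setIntegral_pos_iff_support_of_nonneg_ae
    (Eventually.of_forall fun E => mul_nonneg (Real.sqrt_nonneg _) (hg0 E))
    (integrableOn_continuous_mul hg hb (by fun_prop))]
  have hsub : Ioo (max a c) b ⊆
      Function.support (fun E => √(E ^ 2 - a ^ 2) * g E) ∩ Ioi 0 := by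
    rintro E ⟨hE, hEb⟩
    have hE1 := (le_max_left _ _).trans_lt hE
    have hE2 := (le_max_right _ _).trans_lt hE
    refine ⟨(mul_pos (Real.sqrt_pos.2 ?_) (hpos E hE2 hEb)).ne', ha.trans hE1⟩
    nlinarith
  refine lt_of_lt_of_le ?_ (measure_mono hsub)
  simp [hab, hcb]

end EnergyIntegrals

/-! ### From momentum integrals over ℝ³ to energy moments -/

section MomentumIntegrals

lemma image_energy_Ioi {a : ℝ} (ha : 0 < a) :
    (fun s : ℝ => a * √(1 + s ^ 2)) '' Ioi 0 = Ioi a := by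
  ext E
  constructor
  · rintro ⟨s, hs, rfl⟩
    have : 1 < √(1 + s ^ 2) := Real.lt_sqrt_of_sq_lt (by nlinarith [mem_Ioi.1 hs])
    exact mem_Ioi.2 (by nlinarith)
  · intro hE
    have hE' : a < E := hE
    have h1 : 1 < E / a := (one_lt_div ha).2 hE'
    refine ⟨√((E / a) ^ 2 - 1), Real.sqrt_pos.2 (by nlinarith), ?_⟩
    simp only
    rw [Real.sq_sqrt (by nlinarith), add_sub_cancel, Real.sqrt_sq (by positivity)]
    field_simp

lemma injOn_energy {a : ℝ} (ha : 0 < a) : InjOn (fun s : ℝ => a * √(1 + s ^ 2)) (Ioi 0) := by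
  intro s hs s' hs' h
  have h1 := mul_left_cancel₀ ha.ne' h
  rw [Real.sqrt_inj (by positivity) (by positivity)] at h1
  exact (pow_left_inj₀ (le_of_lt hs) (le_of_lt hs') two_ne_zero).1 (by linarith)

lemma hasDerivAt_energy (a s : ℝ) :
    HasDerivAt (fun s : ℝ => a * √(1 + s ^ 2)) (a * (s / √(1 + s ^ 2))) s := by
  have h := (((hasDerivAt_pow 2 s).const_add 1).sqrt (by positivity)).const_mul a
  refine h.congr_deriv ?_
  simp only [Nat.cast_ofNat, Nat.add_one_sub_one, pow_one]
  field_simp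

/-- The substitution `E = a √(1 + s²)`, for integrands vanishing on `]0,a]`. -/
lemma integral_energy_substitution {a : ℝ} (ha : 0 < a) {G : ℝ → ℝ}
    (hG : ∀ E, 0 < E → E ≤ a → G E = 0) :
    ∫ s in Ioi (0 : ℝ), a * (s / √(1 + s ^ 2)) * G (a * √(1 + s ^ 2)) = ∫ E in Ioi (0 : ℝ), G E := by
  have h1 : ∫ E in Ioi (0 : ℝ), G E = ∫ E in Ioi a, G E := by
    refine setIntegral_eq_of_subset_of_forall_sdiff_eq_zero measurableSet_Ioi
      (Ioi_subset_Ioi ha.le) ?_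
    rintro E ⟨hE, hE'⟩
    exact hG E hE (not_lt.1 hE')
  rw [h1, ← image_energy_Ioi ha, integral_image_eq_integral_abs_deriv_smul measurableSet_Ioi
    (fun s _ => (hasDerivAt_energy a s).hasDerivWithinAt) (injOn_energy ha)]
  refine setIntegral_congr_fun measurableSet_Ioi fun s hs => ?_
  have : 0 < s := hs
  simp only [smul_eq_mul]
  rw [abs_of_nonneg (by positivity)]

lemma integrableOn_energy_substitution {a : ℝ} (ha : 0 < a) {G : ℝ → ℝ}
    (hG : IntegrableOn G (Ioi 0)) :
    IntegrableOn (fun s => a * (s / √(1 + s ^ 2)) * G (a * √(1 + s ^ 2))) (Ioi 0) := by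
  have h1 : IntegrableOn G (Ioi a) := hG.mono_set (Ioi_subset_Ioi ha.le)
  rw [← image_energy_Ioi ha, integrableOn_image_iff_integrableOn_abs_deriv_smul measurableSet_Ioi
    (fun s _ => (hasDerivAt_energy a s).hasDerivWithinAt) (injOn_energy ha)] at h1
  refine h1.congr_fun (fun s hs => ?_) measurableSet_Ioi
  have : 0 < s := hs
  simp only [smul_eq_mul]
  rw [abs_of_nonneg (by positivity)]

lemma sqrt_energy_sq_sub {a s : ℝ} (ha : 0 < a) (hs : 0 ≤ s) :
    √((a * √(1 + s ^ 2)) ^ 2 - a ^ 2) = a * s := by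
  rw [mul_pow, Real.sq_sqrt (by positivity), show a ^ 2 * (1 + s ^ 2) - a ^ 2 = (a * s) ^ 2 by ring,
    Real.sqrt_sq (by positivity)]

variable {g : ℝ → ℝ} {b : ℝ}

/-- Substitute E = a√(1 + s²), so that √(E² - a²) = as; then split E² = (E² - a²) + a². -/
lemma integral_Ioi_momentum_density (hg : IntegrableOn g (Ioi 0)) (hb : ∀ E, b ≤ E → g E = 0)
    {a : ℝ} (ha : 0 < a) :
    a ^ 4 * ∫ s in Ioi (0 : ℝ), s ^ 2 * (√(1 + s ^ 2) * g (a * √(1 + s ^ 2))) =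
      threeHalvesMoment g (a ^ 2) + a ^ 2 * sqrtMoment g (a ^ 2) := by
  rw [← integral_Ioi_sq_mul_sqrt hg hb,
    ← integral_energy_substitution ha (G := fun E => E ^ 2 * √(E ^ 2 - a ^ 2) * g E), ← integral_const_mul]
  · refine setIntegral_congr_fun measurableSet_Ioi fun s hs => ?_
    rw [sqrt_energy_sq_sub ha (le_of_lt hs)]
    have : 0 < √(1 + s ^ 2) := by positivity
    field_simp
  · intro E hE hEa
    rw [Real.sqrt_eq_zero_of_nonpos (by nlinarith)]
    ring

lemma energy_weight_eq {a s : ℝ} (ha : 0 < a) (hs : 0 < s) :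
    a * (s / √(1 + s ^ 2)) * (((a * √(1 + s ^ 2)) ^ 2 - a ^ 2) *
      √((a * √(1 + s ^ 2)) ^ 2 - a ^ 2) * g (a * √(1 + s ^ 2))) =
    a ^ 4 * (s ^ 2 * (s ^ 2 * (g (a * √(1 + s ^ 2)) / √(1 + s ^ 2)))) := by
  rw [sqrt_energy_sq_sub ha hs.le, mul_pow, Real.sq_sqrt (by positivity)]
  have : 0 < √(1 + s ^ 2) := by positivity
  field_simp
  ring

lemma integral_Ioi_momentum_pressure {a : ℝ} (ha : 0 < a) :
    a ^ 4 * ∫ s in Ioi (0 : ℝ), s ^ 2 * (s ^ 2 * (g (a * √(1 + s ^ 2)) / √(1 + s ^ 2))) =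
      threeHalvesMoment g (a ^ 2) := by
  rw [threeHalvesMoment, ← integral_energy_substitution ha
    (G := fun E => (E ^ 2 - a ^ 2) * √(E ^ 2 - a ^ 2) * g E), ← integral_const_mul]
  · exact setIntegral_congr_fun measurableSet_Ioi fun s hs => (energy_weight_eq ha hs).symm
  · intro E hE hEa
    rw [Real.sqrt_eq_zero_of_nonpos (by nlinarith)]
    ring

lemma integrableOn_momentum_pressure (hg : IntegrableOn g (Ioi 0)) (hb : ∀ E, b ≤ E → g E = 0)
    {a : ℝ} (ha : 0 < a) :
    IntegrableOn (fun s => s ^ 2 * (s ^ 2 * (g (a * √(1 + s ^ 2)) / √(1 + s ^ 2)))) (Ioi 0) := by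
  have h := integrableOn_energy_substitution ha
    (integrableOn_continuous_mul (k := fun E => (E ^ 2 - a ^ 2) * √(E ^ 2 - a ^ 2)) hg hb
      (by fun_prop))
  have h2 := (h.congr_fun (fun s hs => energy_weight_eq ha hs) measurableSet_Ioi).const_mul
    ((a ^ 4)⁻¹)
  refine h2.congr (Eventually.of_forall fun s => ?_)
  simp only
  rw [inv_mul_cancel_left₀ (by positivity)]

/-- The dimensional constant `3 vol(B₁(0))` (that is, `4π`) of polar coordinates in `Space`. -/
def sphereArea : ℝ := 3 * volume.real (Metric.ball (0 : Space) 1)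

lemma sphereArea_pos : 0 < sphereArea :=
  mul_pos three_pos (ENNReal.toReal_pos (Metric.measure_ball_pos _ _ one_pos).ne'
    measure_ball_lt_top.ne)

lemma integral_radial (F : ℝ → ℝ) :
    ∫ v : Space, F ‖v‖ = sphereArea * ∫ s in Ioi (0 : ℝ), s ^ 2 * F s := by
  rw [integral_fun_norm_addHaar]
  simp [sphereArea, mul_assoc]

/-- Swapping two coordinates is a linear isometry, hence preserves both the measure and `‖v‖`. -/
lemma integral_coord_sq_eq (F : ℝ → ℝ) (i : Fin 3) :
    ∫ v : Space, v i ^ 2 * F ‖v‖ = ∫ v : Space, v 0 ^ 2 * F ‖v‖ := by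
  let e : Space ≃ₗᵢ[ℝ] Space := LinearIsometryEquiv.piLpCongrLeft 2 ℝ ℝ (Equiv.swap 0 i)
  have h := e.measurePreserving.integral_comp e.toHomeomorph.measurableEmbedding
    (fun v : Space => v i ^ 2 * F ‖v‖)
  rw [← h]
  congr 1 with v
  simp [e, LinearIsometryEquiv.piLpCongrLeft_apply, Equiv.piCongrLeft']

/-- Angular averaging: the square of a coordinate has mean `‖v‖² / 3` on spheres. -/
lemma integral_coord_sq (F : ℝ → ℝ) (hF : Integrable fun v : Space => ‖v‖ ^ 2 * F ‖v‖) :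
    ∫ v : Space, v 0 ^ 2 * F ‖v‖ = (1 / 3) * ∫ v : Space, ‖v‖ ^ 2 * F ‖v‖ := by
  have hint (i : Fin 3) : Integrable fun v : Space => v i ^ 2 * F ‖v‖ := by
    have hle (v : Space) : ‖v i‖ ≤ ‖v‖ := PiLp.norm_apply_le v i
    have heq : (fun v : Space => v i ^ 2 * F ‖v‖) =
        fun v : Space => (v i ^ 2 / ‖v‖ ^ 2) * (‖v‖ ^ 2 * F ‖v‖) := by
      ext v
      rcases eq_or_ne v 0 with rfl | hv
      · simp
      · have := norm_ne_zero_iff.2 hv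
        field_simp
    rw [heq]
    refine hF.bdd_mul (c := 1) (Measurable.aestronglyMeasurable (by fun_prop))
      (Eventually.of_forall fun v => ?_)
    rw [norm_div, norm_pow, norm_pow, norm_norm]
    exact div_le_one_of_le₀ (pow_le_pow_left₀ (norm_nonneg _) (hle v) 2) (by positivity)
  have hsum : ∫ v : Space, ‖v‖ ^ 2 * F ‖v‖ = ∑ i : Fin 3, ∫ v : Space, v i ^ 2 * F ‖v‖ := by
    rw [← integral_finsetSum _ fun i _ => hint i]
    congr 1 with v
    rw [EuclideanSpace.real_norm_sq_eq, Finset.sum_mul]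
  rw [hsum, Finset.sum_congr rfl fun i _ => integral_coord_sq_eq F i]
  simp

end MomentumIntegrals

/-! ### Zero counting and the decisive inequality -/

/-- A function whose derivative is positive at each of its zeros has at most one zero. -/
lemma not_two_zeros_of_deriv_pos {h h' : ℝ → ℝ} {a b : ℝ} (hab : a < b)
    (hd : ∀ x ∈ Icc a b, HasDerivAt h (h' x) x) (hpos : ∀ x ∈ Icc a b, h x = 0 → 0 < h' x)
    (ha : h a = 0) : h b ≠ 0 := by
  intro hb
  have hnonneg : ∀ ⦃x⦄, x ∈ Icc a b → 0 ≤ h x :=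
    image_le_of_deriv_right_lt_deriv_boundary' (f := fun _ => 0) (f' := fun _ => 0)
      continuousOn_const (fun x _ => hasDerivWithinAt_const _ _ _) ha.ge
      (fun x hx => (hd x hx).continuousAt.continuousWithinAt)
      (fun x hx => (hd x (Ico_subset_Icc_self hx)).hasDerivWithinAt)
      fun x hx h0 => hpos x (Ico_subset_Icc_self hx) h0.symm
  have hbmem : b ∈ Icc a b := right_mem_Icc.2 hab.le
  -- A positive derivative at the zero `b` forces `h < 0` just to the left of `b`, against
  -- `hnonneg`.
  have hslope := (hasDerivAt_iff_tendsto_slope_left_right.1 (hd b hbmem)).1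
  have h1 : ∀ᶠ x in 𝓝[<] b, 0 < slope h b x := hslope.eventually_const_lt (hpos b hbmem hb)
  obtain ⟨x, hx, hxa, hxb⟩ := (h1.and (Ioo_mem_nhdsLT hab)).exists
  rw [slope_def_field, hb, sub_zero] at hx
  exact hx.not_ge (div_nonpos_of_nonneg_of_nonpos (hnonneg ⟨hxa.le, hxb.le⟩) (by linarith))

/-- From 1 - 2M ≥ 2/3 one gets q ≤ 3(M + P)/2, so M(1 - 4q) ≥ M(1 - 6M) - 6MP ≥ -P. This loss is
absorbed by P(4 - 3q) ≥ P, leaving R(1 + q) > 0. The bound 2m/r ≤ 1/3 enters here. -/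
lemma well_polynomial_pos {M P R q : ℝ} (hM0 : 0 ≤ M) (hM : M ≤ 1 / 6) (hP : 0 ≤ P) (hR : 0 < R)
    (hq : q * (1 - 2 * M) = M + P) (hq1 : q < 1) :
    0 < R * (1 + q) + M * (1 - 4 * q) + P * (4 - 3 * q) := by
  have hq0 : 0 ≤ q := by
    by_contra! h
    nlinarith
  have hqle : q ≤ 3 / 2 * (M + P) := by nlinarith
  have h1 : 0 < R * (1 + q) := by positivity
  have h2 : -P ≤ M * (1 - 4 * q) := by
    nlinarith [mul_nonneg hM0 (sub_nonneg.2 hM), mul_nonneg hP (sub_nonneg.2 hM),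
      mul_nonneg hM0 (sub_nonneg.2 hqle)]
  nlinarith

lemma norm_radialPoint {r : ℝ} (hr : 0 ≤ r) : ‖radialPoint r‖ = r := by
  simp [radialPoint, abs_of_nonneg hr]

lemma inner_radialPoint_div {r : ℝ} (hr : r ≠ 0) (v : Space) :
    inner ℝ (radialPoint r) v / r = v 0 := by
  simp [radialPoint, EuclideanSpace.inner_single_left, hr]

/-! ### Matter quantities of an isotropic steady state -/

namespace SteadyState

variable (S : SteadyState)

/-- The energy dependence `E ↦ Φ(1 - E/E₀)` of the microscopic equation of state. -/
def profile (E : ℝ) : ℝ := S.Φ (1 - E / S.E₀)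

/-- The radial pressure of the steady state. -/
def p (r : ℝ) : ℝ := radialPressure S.f r

lemma profile_nonneg (E : ℝ) : 0 ≤ S.profile E := S.admissible.nonneg _

lemma profile_eq_zero (E : ℝ) (hE : S.E₀ ≤ E) : S.profile E = 0 :=
  S.admissible.eq_zero _ (sub_nonpos.2 ((one_le_div S.E₀_pos).2 hE))

lemma exists_profile_pos :
    ∃ c, 0 ≤ c ∧ c < S.E₀ ∧ ∀ E, c < E → E < S.E₀ → 0 < S.profile E := by
  obtain ⟨c₁, c₂, α₀, k, hc₁, -, hα₀, -, -, hΦ⟩ := S.admissible.power_bounds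
  have hE₀ := S.E₀_pos
  refine ⟨max 0 (S.E₀ * (1 - α₀)), le_max_left _ _, max_lt hE₀ (by nlinarith), fun E hE hE' => ?_⟩
  have h1 := (le_max_right _ _).trans_lt hE
  have hα : 0 < 1 - E / S.E₀ := sub_pos.2 ((div_lt_one hE₀).2 hE')
  have hα' : 1 - E / S.E₀ ≤ α₀ := by
    have : 1 - α₀ < E / S.E₀ := by
      rw [lt_div_iff₀ hE₀]
      linarith
    linarith
  exact lt_of_lt_of_le (mul_pos hc₁ (Real.rpow_pos_of_pos hα k)) (hΦ _ hα hα').1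

/-- For E > 0 the argument of Φ is below 1, and Φ vanishes on ]-∞,0], so boundedness on [0,1]
suffices. -/
lemma integrableOn_profile : IntegrableOn S.profile (Ioi 0) := by
  have hE₀ := S.E₀_pos
  have h1 : IntegrableOn S.Φ (Icc 0 1) :=
    (S.admissible.locBounded _ isCompact_Icc).integrable le_top
  have h2 : Integrable fun E => (Icc (0 : ℝ) 1).indicator S.Φ (1 - E / S.E₀) :=
    (((integrable_indicator_iff measurableSet_Icc).2 h1).comp_sub_left 1).comp_div hE₀.ne'
  refine h2.integrableOn.congr_fun (fun E hE => ?_) measurableSet_Ioi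
  have hE' : 0 < E / S.E₀ := div_pos hE hE₀
  simp only [indicator, profile, mem_Icc]
  split_ifs with h
  · rfl
  · exact (S.admissible.eq_zero _ (by by_contra! h'; exact h ⟨h'.le, by linarith⟩)).symm

variable {S}

/-- At an energy where Φ is positive it can be cancelled, so the angular momentum factor is constant
in L; at L₀ + 1 it equals 1. -/
lemma IsIsotropic.eqOfState_eq (hiso : S.IsIsotropic) {E L : ℝ} (hL : 0 ≤ L) :
    eqOfState S.Φ S.l S.L₀ S.E₀ E L = S.profile E := by
  obtain ⟨ψ, hψ⟩ := hiso
  obtain ⟨c, hc0, hc, hpos⟩ := S.exists_profile_pos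
  obtain ⟨E₁, hE₁, hE₁'⟩ := exists_between hc
  have hw : ∀ L, 0 ≤ L → (if S.L₀ ≤ L then (L - S.L₀) ^ S.l else 0) = (1 : ℝ) := by
    have hconst (L L' : ℝ) (hL : 0 ≤ L) (hL' : 0 ≤ L') :
        (if S.L₀ ≤ L then (L - S.L₀) ^ S.l else 0) =
          if S.L₀ ≤ L' then (L' - S.L₀) ^ S.l else 0 :=
      mul_left_cancel₀ (hpos E₁ hE₁ hE₁').ne'
        ((hψ E₁ L (hc0.trans_lt hE₁) hL).trans (hψ E₁ L' (hc0.trans_lt hE₁) hL').symm)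
    intro L hL
    rw [hconst L (S.L₀ + 1) hL (by linarith [S.L₀_nonneg])]
    simp
  simp [eqOfState, profile, hw L hL]

lemma IsIsotropic.f_radialPoint (hiso : S.IsIsotropic) {r : ℝ} (hr : 0 < r) (v : Space) :
    S.f (radialPoint r) v = S.profile (Real.exp (S.μ r) * √(1 + ‖v‖ ^ 2)) := by
  rw [f, φ, hiso.eqOfState_eq (by unfold angularMomentum; positivity), particleEnergy,
    norm_radialPoint hr.le]

lemma IsIsotropic.ρ_eq (hiso : S.IsIsotropic) {r : ℝ} (hr : 0 < r) :
    Real.exp (S.μ r) ^ 4 * S.ρ r = sphereArea * (threeHalvesMoment S.profile (Real.exp (S.μ r) ^ 2)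
      + Real.exp (S.μ r) ^ 2 * sqrtMoment S.profile (Real.exp (S.μ r) ^ 2)) := by
  rw [← integral_Ioi_momentum_density S.integrableOn_profile S.profile_eq_zero (Real.exp_pos _),
    ρ, massDensity]
  simp only [hiso.f_radialPoint hr]
  rw [integral_radial fun s => √(1 + s ^ 2) * S.profile (Real.exp (S.μ r) * √(1 + s ^ 2))]
  ring

lemma IsIsotropic.p_eq (hiso : S.IsIsotropic) {r : ℝ} (hr : 0 < r) :
    Real.exp (S.μ r) ^ 4 * S.p r =
      sphereArea / 3 * threeHalvesMoment S.profile (Real.exp (S.μ r) ^ 2) := by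
  have ha := Real.exp_pos (S.μ r)
  rw [← integral_Ioi_momentum_pressure ha, p, radialPressure]
  simp only [hiso.f_radialPoint hr, inner_radialPoint_div hr.ne', mul_div_assoc]
  have hint := (integrable_fun_norm_addHaar (volume : Measure Space)
    (f := fun s => s ^ 2 * (S.profile (Real.exp (S.μ r) * √(1 + s ^ 2)) / √(1 + s ^ 2)))).2 (by
      simpa using integrableOn_momentum_pressure S.integrableOn_profile S.profile_eq_zero ha)
  rw [integral_coord_sq (fun s => S.profile (Real.exp (S.μ r) * √(1 + s ^ 2)) / √(1 + s ^ 2)) hint,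
    integral_radial
      fun s => s ^ 2 * (S.profile (Real.exp (S.μ r) * √(1 + s ^ 2)) / √(1 + s ^ 2))]
  ring

lemma IsIsotropic.ρ_pos (hiso : S.IsIsotropic) {r : ℝ} (hr : 0 < r)
    (h : Real.exp (S.μ r) < S.E₀) : 0 < S.ρ r := by
  obtain ⟨c, -, hc, hpos⟩ := S.exists_profile_pos
  have ha := Real.exp_pos (S.μ r)
  have hJ := sqrtMoment_pos S.integrableOn_profile S.profile_eq_zero S.profile_nonneg ha h hc hpos
  have hK := threeHalvesMoment_nonneg S.profile_nonneg (Real.exp (S.μ r) ^ 2)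
  have hA := sphereArea_pos
  refine pos_of_mul_pos_right (a := Real.exp (S.μ r) ^ 4) ?_ (by positivity)
  rw [hiso.ρ_eq hr]
  positivity

variable (S) in
lemma f_nonneg (x v : Space) : 0 ≤ S.f x v := by
  unfold f φ eqOfState
  refine mul_nonneg (S.admissible.nonneg _) ?_
  split_ifs with h
  · exact Real.rpow_nonneg (sub_nonneg.2 h) _
  · exact le_rfl

variable (S) in
lemma ρ_nonneg (r : ℝ) : 0 ≤ S.ρ r :=
  integral_nonneg fun v => mul_nonneg (Real.sqrt_nonneg _) (S.f_nonneg _ v)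

variable (S) in
lemma p_nonneg (r : ℝ) : 0 ≤ S.p r :=
  integral_nonneg fun v =>
    div_nonneg (mul_nonneg (sq_nonneg _) (S.f_nonneg _ v)) (Real.sqrt_nonneg _)

/-- The Tolman-Oppenheimer-Volkoff equation `p' = -(ρ + p) μ'`. -/
lemma IsIsotropic.hasDerivAt_p (hiso : S.IsIsotropic) {r : ℝ} (hr : 0 < r) :
    HasDerivAt S.p (-(S.ρ r + S.p r) * deriv S.μ r) r := by
  have hμ := (S.μ_differentiableAt r hr).hasDerivAt.exp
  have ha := Real.exp_pos (S.μ r)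
  -- With a = e^μ, the product a⁴p is a multiple of the 3/2 moment at a². Its derivative brings in
  -- the 1/2 moment, and the two moments recombine to ρ + p.
  have hK := (hasDerivAt_threeHalvesMoment S.integrableOn_profile S.profile_eq_zero
    (Real.exp (S.μ r) ^ 2)).comp r (hμ.pow 2)
  have h := (hK.const_mul (sphereArea / 3)).div (hμ.pow 4) (pow_pos ha 4).ne'
  have heq : S.p =ᶠ[𝓝 r] fun s =>
      sphereArea / 3 * threeHalvesMoment S.profile (Real.exp (S.μ s) ^ 2) /
        Real.exp (S.μ s) ^ 4 := by
    filter_upwards [lt_mem_nhds hr] with s hs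
    rw [← hiso.p_eq hs]
    field_simp
  refine (h.congr_of_eventuallyEq heq).congr_deriv ?_
  have h1 := hiso.ρ_eq hr
  have h2 := hiso.p_eq hr
  simp only [Function.comp_apply, Pi.pow_apply]
  rw [div_eq_iff (by positivity)]
  generalize Real.exp (S.μ r) = a at *
  push_cast
  linear_combination (a ^ 4 * deriv S.μ r) * h1 + (a ^ 4 * deriv S.μ r) * h2

/-! ### Consequences of the field equations -/

variable (S) in
-- The density equation says (r(1 - e^{-2λ}))' = 8πr²ρ; integrate from the centre.
lemma exp_lam_eq {r : ℝ} (hr : 0 < r) : Real.exp (-2 * S.lam r) = 1 - 2 * S.m r / r := by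
  have hderiv : ∀ s ∈ Ioo 0 r, HasDerivAt (fun s => s * (1 - Real.exp (-2 * S.lam s)))
      (8 * Real.pi * (S.ρ s * s ^ 2)) s := by
    intro s hs
    have h := (hasDerivAt_id s).mul
      (((S.lam_differentiableAt s hs.1).hasDerivAt.const_mul (-2)).exp.const_sub 1)
    refine h.congr_deriv ?_
    have hf : Real.exp (-2 * S.lam s) * (2 * s * deriv S.lam s - 1) + 1 =
      8 * Real.pi * s ^ 2 * S.ρ s := S.fieldEq_density s hs.1
    simp only [id]
    linear_combination hf
  have hcont : ContinuousOn (fun s => s * (1 - Real.exp (-2 * S.lam s))) (Icc 0 r) := by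
    have := S.lam_continuousOn.mono (Icc_subset_Ici_self : Icc 0 r ⊆ Ici 0)
    fun_prop
  -- Integrability of ρs² is not assumed: a non-negative derivative of a continuous function is
  -- integrable.
  have hint : IntervalIntegrable (fun s => 8 * Real.pi * (S.ρ s * s ^ 2)) volume 0 r :=
    (intervalIntegrable_iff_integrableOn_Ioc_of_le hr.le).2
      (intervalIntegral.integrableOn_deriv_of_nonneg hcont hderiv fun s _ => by
        have := S.ρ_nonneg s
        positivity)
  have h := intervalIntegral.integral_eq_sub_of_hasDerivAt_of_le hr.le hcont hderiv hint
  rw [intervalIntegral.integral_const_mul, zero_mul, sub_zero] at h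
  have hm : 2 * S.m r = r * (1 - Real.exp (-2 * S.lam r)) := by
    rw [← h, m]
    ring
  rw [hm]
  field_simp
  ring

variable (S) in
lemma m_nonneg {r : ℝ} (hr : 0 < r) : 0 ≤ S.m r :=
  mul_nonneg (by positivity) (intervalIntegral.integral_nonneg hr.le fun s _ =>
    mul_nonneg (S.ρ_nonneg s) (sq_nonneg s))

variable (S) in
/-- The logarithmic derivative `r μ'(r)`, expressed through `λ` and the pressure. -/
def logSlope (r : ℝ) : ℝ := (Real.exp (2 * S.lam r) * (1 + 8 * Real.pi * r ^ 2 * S.p r) - 1) / 2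

variable (S) in
lemma exp_two_lam_mul (r : ℝ) : Real.exp (2 * S.lam r) * Real.exp (-2 * S.lam r) = 1 := by
  rw [← Real.exp_add]
  simp

variable (S) in
lemma mul_deriv_μ {r : ℝ} (hr : 0 < r) : r * deriv S.μ r = S.logSlope r := by
  have hf : Real.exp (-2 * S.lam r) * (2 * r * deriv S.μ r + 1) - 1 =
      8 * Real.pi * r ^ 2 * S.p r := S.fieldEq_pressure r hr
  have h := S.exp_two_lam_mul r
  rw [logSlope]
  linear_combination (1 / 2 * Real.exp (2 * S.lam r)) * hf - (r * deriv S.μ r + 1 / 2) * h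

variable (S) in
lemma logSlope_mul {r : ℝ} (hr : 0 < r) :
    S.logSlope r * (1 - 2 * (S.m r / r)) = S.m r / r + 4 * Real.pi * r ^ 2 * S.p r := by
  have h1 : 1 - 2 * (S.m r / r) = Real.exp (-2 * S.lam r) := by
    rw [S.exp_lam_eq hr]
    ring
  have h := S.exp_two_lam_mul r
  rw [show S.m r / r = (1 - Real.exp (-2 * S.lam r)) / 2 by linarith, logSlope]
  linear_combination (1 / 2 + 4 * Real.pi * r ^ 2 * S.p r) * h

variable (S) in
-- In q(1 - 2M) = M + P the right side is non-negative, and 1 - 2M = e^{-2λ} > 0.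
lemma deriv_μ_nonneg {r : ℝ} (hr : 0 < r) : 0 ≤ deriv S.μ r := by
  have h1 := S.logSlope_mul hr
  have h2 : 1 - 2 * (S.m r / r) = Real.exp (-2 * S.lam r) := by
    rw [S.exp_lam_eq hr]
    ring
  have hm := S.m_nonneg hr
  have hp := S.p_nonneg r
  rw [h2, ← S.mul_deriv_μ hr] at h1
  have h3 : 0 ≤ deriv S.μ r * (r * Real.exp (-2 * S.lam r)) := by
    rw [show deriv S.μ r * (r * Real.exp (-2 * S.lam r)) =
      r * deriv S.μ r * Real.exp (-2 * S.lam r) by ring, h1]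
    positivity
  exact nonneg_of_mul_nonneg_left h3 (by positivity)

variable (S) in
lemma monotoneOn_μ : MonotoneOn S.μ (Ici 0) := by
  refine monotoneOn_of_deriv_nonneg (convex_Ici 0) S.μ_continuousOn ?_ ?_
  · rw [interior_Ici]
    exact fun x hx => (S.μ_differentiableAt x hx).differentiableWithinAt
  · rw [interior_Ici]
    exact fun x hx => S.deriv_μ_nonneg hx

lemma IsIsotropic.hasDerivAt_logSlope (hiso : S.IsIsotropic) {r : ℝ} (hr : 0 < r) :
    HasDerivAt S.logSlope (Real.exp (2 * S.lam r) * (deriv S.lam r *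
      (1 + 8 * Real.pi * r ^ 2 * S.p r) + 8 * Real.pi * r * S.p r -
        4 * Real.pi * r ^ 2 * ((S.ρ r + S.p r) * deriv S.μ r))) r := by
  have h := (((((S.lam_differentiableAt r hr).hasDerivAt.const_mul 2).exp.mul
    ((((hasDerivAt_pow 2 r).const_mul (8 * Real.pi)).mul (hiso.hasDerivAt_p hr)).const_add
      1)).sub_const 1).div_const 2)
  refine h.congr_deriv ?_
  simp only [Pi.mul_apply, Nat.cast_ofNat, Nat.add_one_sub_one, pow_one]
  ring

/-! ### Critical points of the effective potential -/

variable (S) in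
lemma effPotential_hasDerivAt {L r : ℝ} (hL : 0 < L) (hr : 0 < r) :
    HasDerivAt (S.effPotential L)
      (Real.exp (S.μ r) / (√(1 + L / r ^ 2) * r ^ 3) * (S.logSlope r * (r ^ 2 + L) - L)) r := by
  have hw : 0 < 1 + L / r ^ 2 := by positivity
  have h := (S.μ_differentiableAt r hr).hasDerivAt.exp.mul
    ((((hasDerivAt_const r L).div (hasDerivAt_pow 2 r) (by positivity)).const_add 1).sqrt hw.ne')
  refine h.congr_deriv ?_
  have hs : 0 < √(1 + L / r ^ 2) := Real.sqrt_pos.2 hw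
  have hs2 : √(1 + L / r ^ 2) ^ 2 = 1 + L / r ^ 2 := Real.sq_sqrt hw.le
  rw [← S.mul_deriv_μ hr]
  simp only [Pi.div_apply, Nat.cast_ofNat, Nat.add_one_sub_one, pow_one]
  generalize √(1 + L / r ^ 2) = w at *
  field_simp at hs2 ⊢
  linear_combination (2 * r * deriv S.μ r) * hs2

variable (S) in
lemma deriv_effPotential_eq_zero_iff {L r : ℝ} (hL : 0 < L) (hr : 0 < r) :
    deriv (S.effPotential L) r = 0 ↔ S.logSlope r * (r ^ 2 + L) - L = 0 := by
  rw [(S.effPotential_hasDerivAt hL hr).deriv, mul_eq_zero, or_iff_right]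
  positivity

/-- Where the Buchdahl-type quotient is at most `1/3` and matter is present, the critical points of
the effective potential are non-degenerate minima. -/
lemma deriv_pos_at_critical {L r : ℝ} (hL : 0 < L) (hr : 0 < r)
    (hm : 2 * S.m r / r ≤ 1 / 3) (hρ : 0 < S.ρ r) (h0 : S.logSlope r * (r ^ 2 + L) - L = 0) :
    0 < Real.exp (2 * S.lam r) * (deriv S.lam r *
      (1 + 8 * Real.pi * r ^ 2 * S.p r) + 8 * Real.pi * r * S.p r -
        4 * Real.pi * r ^ 2 * ((S.ρ r + S.p r) * deriv S.μ r)) * (r ^ 2 + L)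
      + S.logSlope r * (2 * r) := by
  have hAB := S.exp_two_lam_mul r
  have hB := S.exp_lam_eq hr
  have hA := Real.exp_pos (2 * S.lam r)
  have hμ := S.mul_deriv_μ hr
  have hqM := S.logSlope_mul hr
  have hf : Real.exp (-2 * S.lam r) * (2 * r * deriv S.lam r - 1) + 1 =
    8 * Real.pi * r ^ 2 * S.ρ r := S.fieldEq_density r hr
  have hq : Real.exp (2 * S.lam r) * (1 + 8 * Real.pi * r ^ 2 * S.p r) =
      1 + 2 * S.logSlope r := by
    rw [logSlope]
    ring
  have hp := S.p_nonneg r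
  have hM0 := div_nonneg (S.m_nonneg hr) hr.le
  have hM : S.m r / r ≤ 1 / 6 := by
    rw [mul_div_assoc] at hm
    linarith
  rw [mul_div_assoc] at hB
  rw [hB] at hAB hf
  have hq1 : S.logSlope r < 1 := by nlinarith [sq_nonneg r]
  have hpoly := well_polynomial_pos (R := 4 * Real.pi * r ^ 2 * S.ρ r) hM0 hM
    (show 0 ≤ 4 * Real.pi * r ^ 2 * S.p r by positivity) (by positivity) hqM hq1
  -- This factor eliminates L, since (r² + L)(1 - q) = r² at a zero; what remains is r²e^{2λ} times
  -- the expression in `hpoly`.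
  refine pos_of_mul_pos_left (b := r * (1 - S.logSlope r)) ?_
    (mul_nonneg hr.le (sub_nonneg.2 hq1.le))
  refine (mul_pos (mul_pos (pow_pos hr 2) hA) hpoly).trans_eq ?_
  generalize Real.exp (2 * S.lam r) = A at *
  generalize S.logSlope r = q at *
  generalize S.m r / r = M at *
  have hq2 : q = A * (M + 4 * Real.pi * r ^ 2 * S.p r) := by
    linear_combination A * hqM - q * hAB
  have hlam : r * deriv S.lam r = A * (4 * Real.pi * r ^ 2 * S.ρ r - M) := by
    linear_combination (A / 2) * hf - (r * deriv S.lam r) * hAB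
  have hrL : (r ^ 2 + L) * (1 - q) = r ^ 2 := by linear_combination -h0
  have hqd : A * (deriv S.lam r * (1 + 8 * Real.pi * r ^ 2 * S.p r) + 8 * Real.pi * r * S.p r -
      4 * Real.pi * r ^ 2 * ((S.ρ r + S.p r) * deriv S.μ r)) * r =
      A * ((4 * Real.pi * r ^ 2 * S.ρ r - M) * (1 + 2 * q) + 2 * (4 * Real.pi * r ^ 2 * S.p r) -
        (4 * Real.pi * r ^ 2 * S.ρ r + 4 * Real.pi * r ^ 2 * S.p r) * q) := by
    linear_combination (r * deriv S.lam r) * hq + (1 + 2 * q) * hlam -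
      (A * (4 * Real.pi * r ^ 2 * S.ρ r + 4 * Real.pi * r ^ 2 * S.p r)) * hμ
  linear_combination (-(r ^ 2 + L) * (1 - q)) * hqd - (2 * r ^ 2 * (1 - q)) * hq2 -
    (A * ((4 * Real.pi * r ^ 2 * S.ρ r - M) * (1 + 2 * q) + 2 * (4 * Real.pi * r ^ 2 * S.p r) -
        (4 * Real.pi * r ^ 2 * S.ρ r + 4 * Real.pi * r ^ 2 * S.p r) * q)) * hrL

/-! ### Uniqueness and existence of the critical point -/

theorem IsIsotropic.hasSingleWellStructure (hiso : S.IsIsotropic)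
    (hm : ∀ r : ℝ, 0 < r → 2 * S.m r / r ≤ 1 / 3) : S.HasSingleWellStructure := by
  rintro L hL - ⟨r₀, hr₀, hΨ₀, -⟩
  have hE₀ := S.E₀_pos
  have hexp_le (r : ℝ) (hr : 0 < r) : Real.exp (S.μ r) ≤ S.effPotential L r :=
    le_mul_of_one_le_right (Real.exp_pos _).le
      (Real.one_le_sqrt.2 (le_add_of_nonneg_right (by positivity)))
  have huniq (a b : ℝ) (ha : 0 < a) (hab : a < b) (hb : S.effPotential L b < S.E₀)
      (ha0 : deriv (S.effPotential L) a = 0) : deriv (S.effPotential L) b ≠ 0 := by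
    rw [ne_eq, S.deriv_effPotential_eq_zero_iff hL (ha.trans hab)]
    refine not_two_zeros_of_deriv_pos (h := fun r => S.logSlope r * (r ^ 2 + L) - L) hab
      (fun x hx => ?_) (fun x hx hx0 => deriv_pos_at_critical hL (ha.trans_le hx.1)
        (hm x (ha.trans_le hx.1)) (hiso.ρ_pos (ha.trans_le hx.1) ?_) hx0)
      ((S.deriv_effPotential_eq_zero_iff hL ha).1 ha0)
    · have h := ((hiso.hasDerivAt_logSlope (ha.trans_le hx.1)).mul
        ((hasDerivAt_pow 2 x).add_const L)).sub_const L
      refine h.congr_deriv ?_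
      norm_num
    · have hle := S.monotoneOn_μ (ha.trans_le hx.1).le (ha.trans hab).le hx.2
      exact (Real.exp_le_exp.2 hle).trans_lt ((hexp_le b (ha.trans hab)).trans_lt hb)
  have hex : ∃ c, 0 < c ∧ S.effPotential L c < S.E₀ ∧ deriv (S.effPotential L) c = 0 := by
    -- Since μ tends to 0 > ln E₀, far out e^μ alone exceeds E₀.
    obtain ⟨R, hRμ, hR⟩ := ((S.μ_tendsto.eventually_const_lt
      (Real.log_neg hE₀ S.E₀_lt_one)).and (eventually_gt_atTop r₀)).exists
    have hR0 : 0 < R := hr₀.trans hR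
    have hRΨ : S.E₀ ≤ S.effPotential L R :=
      (((Real.log_lt_iff_lt_exp hE₀).1 hRμ).trans_le (hexp_le R hR0)).le
    obtain ⟨δ, hδ, hδr, hδΨ⟩ : ∃ δ, 0 < δ ∧ δ < r₀ ∧ S.E₀ ≤ S.effPotential L δ := by
      -- Chosen so that Ψ_L(δ) ≥ e^{μ(0)}√L/δ ≥ E₀, using that μ is increasing.
      set δ := min (r₀ / 2) (Real.exp (S.μ 0) * √L / S.E₀) with hδdef
      have hδ : 0 < δ := lt_min (by positivity) (by positivity)
      refine ⟨δ, hδ, (min_le_left _ _).trans_lt (by linarith), ?_⟩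
      have h1 : δ ≤ Real.exp (S.μ 0) * √L / S.E₀ := min_le_right _ _
      rw [le_div_iff₀ hE₀, ← le_div_iff₀' hδ, mul_div_assoc] at h1
      refine h1.trans (mul_le_mul (Real.exp_le_exp.2 (S.monotoneOn_μ self_mem_Ici hδ.le hδ.le))
        ?_ (by positivity) (by positivity))
      refine Real.le_sqrt_of_sq_le ?_
      rw [div_pow, Real.sq_sqrt hL.le]
      linarith
    have hcont : ContinuousOn (S.effPotential L) (Icc δ R) := fun x hx =>
      (S.effPotential_hasDerivAt hL (hδ.trans_le hx.1)).continuousAt.continuousWithinAt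
    obtain ⟨c, hc, hmin⟩ := isCompact_Icc.exists_isMinOn ⟨r₀, hδr.le, hR.le⟩ hcont
    have hcΨ : S.effPotential L c < S.E₀ := (hmin ⟨hδr.le, hR.le⟩).trans_lt hΨ₀
    have hδc : δ < c := hc.1.lt_of_ne (by rintro rfl; exact hcΨ.not_ge hδΨ)
    have hcR : c < R := hc.2.lt_of_ne (by rintro rfl; exact hcΨ.not_ge hRΨ)
    exact ⟨c, hδ.trans hδc, hcΨ, (hmin.isLocalMin (Icc_mem_nhds hδc hcR)).deriv_eq_zero⟩
  obtain ⟨c, hc, hcΨ, hc0⟩ := hex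
  refine ⟨c, ⟨⟨hc, hcΨ, hiso.ρ_pos hc ((hexp_le c hc).trans_lt hcΨ)⟩, hc0⟩, ?_⟩
  rintro r ⟨⟨hr, hrΨ, -⟩, hr0⟩
  rcases lt_trichotomy r c with h | h | h
  · exact absurd hc0 (huniq r c hr h hcΨ hr0)
  · exact h
  · exact absurd hr0 (huniq c r hc h hrΨ hc0)

end SteadyState
end EinsteinVlasov
end

theorem mainTheorem5 (S : EinsteinVlasov.SteadyState) (hiso : S.IsIsotropic)
    (hm : ∀ r : ℝ, 0 < r → 2 * S.m r / r ≤ 1 / 3) :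
    S.HasSingleWellStructure :=
  hiso.hasSingleWellStructure hm
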